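/- Let $G$ be a finite directed graph. For vertices $u,v$ let $d(u,v)\in\{0,1,2,\dots\}\cup\{\infty\}$ be the length of a shortest directed path from $u$ to $v$ ($\infty$ if there is none). In the Localization game with $k\ge 1$ cops on $G$, an invisible robber first chooses a vertex; in each round the cops choose vertices $u_1,\dots,u_k$ and learn the distance vector $(d(u_1,x),\dots,d(u_k,x))$, where $x$ is the robber's current vertex, and then the robber stays on $x$ or moves along an arc to an out-neighbour of $x$. The cops choose each probe knowing all earlier distance vectors, and they win if they have a strategy that, against every behaviour of the robber, after finitely many rounds leaves exactly one vertex as possible current position of the robber consistent with all distance vectors obtained so far. The localization number $\zeta(G)$ is the least positive integer $k$ for which $k$ cops have a winning strategy. For $0<p<1$ let $T(n,p)$ be the random tournament on $\{1,\dots,n\}$ in which, independently for each pair $i<j$, the arc is $(i,j)$ with probability $p$ and $(j,i)$ with probability $1-p$. **Theorem.** Let $0<p<1$ be constant and $\rho=p^2+(1-p)^2$. Then there are real sequences $\varepsilon_1(n)\to 0$ and $\varepsilon_2(n)\to 0$ such that, with probability tending to $1$ as $n\to\infty$, $$(1+\varepsilon_1(n))\log_2 n\ \le\ \zeta(T(n,p))\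 \le\ (2+\varepsilon_2(n))\,\frac{\log n}{\log(1/\rho)}.$$ Moreover, there are real sequences $\varepsilon_1(n)\to 0$ and $\varepsilon_2(n)\to 0$ such that, as $n\to\infty$, the proportion of the tournaments $G$ on $\{1,\dots,n\}$ (among all $2^{\binom n2}$ of them) for which $$(1+\varepsilon_1(n))\log_2 n\ \le\ \zeta(G)\ \le\ (2+\varepsilon_2(n))\log_2 n$$ holds tends to $1$. -/

import Mathlib

open MeasureTheory ProbabilityTheory Filter Topology

namespace Digraph

/-- A tournament: no loops, and exactly one arc between any two distinct vertices. -/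
def IsTournament {V : Type*} (G : Digraph V) : Prop :=
  (∀ v, ¬ G.Adj v v) ∧ ∀ u v, u ≠ v → Xor (G.Adj u v) (G.Adj v u)

/-- There is a directed walk of length `n` from `u` to `v`. -/
def HasWalk {V : Type*} (G : Digraph V) : ℕ → V → V → Prop
  | 0, u, v => u = v
  | n + 1, u, v => ∃ w, G.Adj u w ∧ HasWalk G n w v

/-- The directed distance from `u` to `v`: the least length of a directed walk
(equivalently, of a directed path) from `u` to `v`, and `⊤` if there is none. -/
noncomputable def dirDist {V : Type*} (G : Digraph V) (u v : V) : ℕ∞ :=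
  ⨅ (n : ℕ) (_ : G.HasWalk n u v), (n : ℕ∞)

/-- The distance vector obtained when the cops on `u 0, …, u (k - 1)` probe a robber on `x`:
the `i`-th entry is the distance from the `i`-th cop to the robber. -/
noncomputable def distVector {V : Type*} (G : Digraph V) {k : ℕ} (u : Fin k → V) (x : V) :
    Fin k → ℕ∞ :=
  fun i => G.dirDist (u i) x

/-- A possible course of the robber: `r t` is the position of the robber at the `t`-th probe.
The first position is arbitrary, and between two probes the robber stays or follows an arc. -/
def IsRobberCourse {V : Type*} (G : Digraph V) (r : ℕ → V) : Prop :=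
  ∀ t, r (t + 1) = r t ∨ G.Adj (r t) (r (t + 1))

/-- A strategy of `k` cops: from the list of all distance vectors obtained so far, it
determines the positions of the next probe (arbitrary vertices of the digraph). -/
abbrev CopStrategy (V : Type*) (k : ℕ) : Type _ :=
  List (Fin k → ℕ∞) → (Fin k → V)

/-- The distance vectors that the cops have obtained in the first `t` rounds when they follow
the strategy `σ` and the robber follows the course `r`. -/
noncomputable def probeHistory {V : Type*} (G : Digraph V) {k : ℕ} (σ : CopStrategy V k)
    (r : ℕ → V) : ℕ → List (Fin k → ℕ∞)
  | 0 => []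
  | t + 1 => probeHistory G σ r t ++ [G.distVector (σ (probeHistory G σ r t)) (r t)]

/-- `x` is a candidate for the robber's position at the `t`-th probe (counted from `0`): some
course of the robber ends there and explains all distance vectors obtained up to and
including that probe. -/
def IsCandidate {V : Type*} (G : Digraph V) {k : ℕ} (σ : CopStrategy V k)
    (r : ℕ → V) (t : ℕ) (x : V) : Prop :=
  ∃ r' : ℕ → V, G.IsRobberCourse r' ∧
    G.probeHistory σ r' (t + 1) = G.probeHistory σ r (t + 1) ∧ r' t = x

/-- `k` cops have a winning strategy in the Localization game on `G`: whatever course the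
robber takes, after finitely many rounds there is a unique candidate. -/
def CopsWin {V : Type*} (G : Digraph V) (k : ℕ) : Prop :=
  ∃ σ : CopStrategy V k, ∀ r : ℕ → V, G.IsRobberCourse r → ∃ t, ∃! x, G.IsCandidate σ r t x

/-- The localization number `ζ(G)`: the least positive number of cops with a winning strategy.
(On a finite nonempty digraph, as many cops as there are vertices win in the first round.) -/
noncomputable def localizationNumber {V : Type*} (G : Digraph V) : ℕ :=
  sInf {k : ℕ | 0 < k ∧ G.CopsWin k}

/-- On a set of digraphs, every subset is an event. -/
instance instMeasurableSpaceDigraph {V : Type*} : MeasurableSpace (Digraph V) := ⊤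

end Digraph

/-- The tournament on `Fin n` given by one bit for each pair `i < j`:
the arc is `(i, j)` if the bit is `true` and `(j, i)` if it is `false`. -/
def tournamentOfBits {n : ℕ} (b : {e : Fin n × Fin n // e.1 < e.2} → Bool) : Digraph (Fin n) where
  Adj i j := (∃ h : i < j, b ⟨(i, j), h⟩ = true) ∨ (∃ h : j < i, b ⟨(j, i), h⟩ = false)

/-- The law of the random tournament `T(n,p)`: independently for each pair `i < j`, the arc is
`(i, j)` with probability `p` and `(j, i)` with probability `1 - p`. -/
noncomputable def randomTournament (n : ℕ) (p : unitInterval) : Measure (Digraph (Fin n)) :=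
  (Measure.pi fun _ : {e : Fin n × Fin n // e.1 < e.2} => bernoulliMeasure true false p).map
    tournamentOfBits

/-! Upper bound: one probe of a fixed `k`-set already wins. A vertex separates `x` from `y` if it is
one of them or is adjacent to exactly one of them; for a fixed pair, each outside vertex fails to do
so by adjacency with probability at most `ρ`, independently. A union bound over pairs leaves failure
probability at most `n ^ 2 * ρ ^ k`, which vanishes for `k` slightly above `2 log n / log (1 / ρ)`
(`randomTournament_real_not_copsWin_le`).

Lower bound: with high probability any two vertices are joined by 2-paths through each of the `n /
L` blocks, `L ≈ log² n`. Unprobed vertices then have distance 1 or 2 from every cop, so they show at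
most `2 ^ k` vectors, while all out-degrees are at least `n / L`. If `n / L > 2 ^ k + k`, the robber
can always move to one of two out-neighbours that the next probe confuses
(`not_copsWin_of_exists_pair`). Hence `ζ` is at least about `log₂ (n / L) ~ log₂ n`.

The counting statement is the case `p = 1 / 2`, where the law is uniform on tournaments. -/

namespace Digraph

variable {V : Type*} {G : Digraph V}

/-! ### Distances and deterministic criteria for the game -/

lemma dirDist_le_of_hasWalk {n : ℕ} {u v : V} (h : G.HasWalk n u v) : G.dirDist u v ≤ n :=
  iInf₂_le n h

lemma dirDist_self (u : V) : G.dirDist u u = 0 :=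
  le_antisymm (dirDist_le_of_hasWalk (n := 0) rfl) bot_le

lemma one_le_dirDist {u v : V} (h : u ≠ v) : 1 ≤ G.dirDist u v := by
  refine le_iInf₂ fun n hn => ?_
  match n, hn with
  | 0, hn => exact absurd hn h
  | n + 1, _ => exact_mod_cast Nat.le_add_left 1 n

lemma dirDist_eq_one {u v : V} (h : u ≠ v) (ha : G.Adj u v) : G.dirDist u v = 1 :=
  le_antisymm (dirDist_le_of_hasWalk (n := 1) ⟨v, ha, rfl⟩) (one_le_dirDist h)

lemma two_le_dirDist {u v : V} (h : u ≠ v) (ha : ¬ G.Adj u v) : 2 ≤ G.dirDist u v := by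
  refine le_iInf₂ fun n hn => ?_
  match n, hn with
  | 0, hn => exact absurd hn h
  | 1, hn =>
    obtain ⟨w, hw, rfl⟩ := hn
    exact absurd hw ha
  | n + 2, _ => exact_mod_cast Nat.le_add_left 2 n

lemma dirDist_eq_two {u v w : V} (h : u ≠ v) (ha : ¬ G.Adj u v) (huw : G.Adj u w)
    (hwv : G.Adj w v) : G.dirDist u v = 2 :=
  le_antisymm (dirDist_le_of_hasWalk (n := 2) ⟨w, huw, v, hwv, rfl⟩) (two_le_dirDist h ha)

/-- A vertex that equals `x` or `y`, or is adjacent to exactly one of them, distinguishes them. -/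
lemma dirDist_ne_of_adj_ne {u x y : V} (h : u = x ∨ u = y ∨ ¬ (G.Adj u x ↔ G.Adj u y))
    (hxy : x ≠ y) : G.dirDist u x ≠ G.dirDist u y := by
  intro he
  have key : ∀ {a b : V}, G.dirDist u a = G.dirDist u b → u = a → a = b := by
    rintro a b he rfl
    by_contra hb
    have := one_le_dirDist (G := G) hb
    rw [← he, dirDist_self] at this
    simp at this
  by_cases hx : u = x
  · exact hxy (key he hx)
  by_cases hy : u = y
  · exact hxy (key he.symm hy).symm
  have key' : ∀ {a b : V}, u ≠ a → u ≠ b → G.dirDist u a = G.dirDist u b → G.Adj u a →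
      G.Adj u b := by
    intro a b ha hb he hadj
    by_contra hn
    have := two_le_dirDist hb hn
    rw [← he, dirDist_eq_one ha hadj] at this
    exact absurd this (by decide)
  rcases h with h | h | h
  · exact hx h
  · exact hy h
  · exact h ⟨key' hx hy he, key' hy hx he.symm⟩

lemma copsWin_of_resolving {k : ℕ} (u : Fin k → V)
    (hu : ∀ x y, x ≠ y → ∃ i, G.dirDist (u i) x ≠ G.dirDist (u i) y) : G.CopsWin k := by
  refine ⟨fun _ => u, fun r hr => ⟨0, r 0, ⟨r, hr, rfl, rfl⟩, ?_⟩⟩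
  rintro _ ⟨r', -, hh, rfl⟩
  by_contra hne
  obtain ⟨i, hi⟩ := hu _ _ hne
  simp only [probeHistory, List.nil_append, List.cons.injEq, and_true] at hh
  exact hi (congrFun hh i)

lemma probeHistory_congr {k : ℕ} (σ : CopStrategy V k) {r r' : ℕ → V} {t : ℕ}
    (h : ∀ s < t, r s = r' s) : G.probeHistory σ r t = G.probeHistory σ r' t := by
  induction t with
  | zero => rfl
  | succ t ih =>
    simp only [probeHistory]
    rw [ih fun s hs => h s (by omega), h t (by omega)]

/-- The robber escapes if, from every vertex and against every probe, two distinct vertices that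
can be reached in one step give the same answer. -/
lemma not_copsWin_of_exists_pair [Nonempty V] {k : ℕ}
    (H : ∀ (u : Fin k → V) (x : V), ∃ y z, y ≠ z ∧ G.Adj x y ∧ G.Adj x z ∧
      G.distVector u y = G.distVector u z) : ¬ G.CopsWin k := by
  rintro ⟨σ, hσ⟩
  choose f g hfg hf hg hd using H
  -- A state is the history so far with the robber's last position. The robber answers the probe
  -- that `σ` is about to make, starting from a fictitious vertex before the first round.
  let state : ℕ → List (Fin k → ℕ∞) × V := fun t =>
    Nat.rec ([], Classical.arbitrary V)
      (fun _ s => (s.1 ++ [G.distVector (σ s.1) (f (σ s.1) s.2)], f (σ s.1) s.2)) t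
  let r : ℕ → V := fun t => (state (t + 1)).2
  have hr : G.IsRobberCourse r := fun t => Or.inr (hf _ _)
  have hist : ∀ t, G.probeHistory σ r t = (state t).1 := by
    intro t
    induction t with
    | zero => rfl
    | succ t ih =>
      simp only [probeHistory]
      rw [ih]
  obtain ⟨t, x, -, hx⟩ := hσ r hr
  let z := g (σ (state t).1) (state t).2
  -- The deviating course makes the other choice `z` at time `t` and stays there, so `z` is a second
  -- candidate at that time.
  let r' : ℕ → V := fun s => if s < t then r s else z
  have hr' : G.IsRobberCourse r' := by
    intro s
    rcases lt_trichotomy (s + 1) t with h | h | h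
    · simp only [r', h, show s < t by omega, if_true]
      exact hr s
    · subst h
      simp only [r', lt_irrefl, if_false, show s < s + 1 by omega, if_true]
      exact Or.inr (hg _ _)
    · left
      simp only [r', show ¬ s + 1 < t by omega, show ¬ s < t by omega, if_false]
  have hh : G.probeHistory σ r' t = G.probeHistory σ r t :=
    probeHistory_congr σ fun s hs => by simp [r', hs]
  have hz : r' t = z := by simp [r']
  have hcand : G.IsCandidate σ r t z := by
    refine ⟨r', hr', ?_, hz⟩
    simp only [probeHistory]
    rw [hh, hz, hist]
    congr 2
    exact (hd _ _).symm
  have hcand' : G.IsCandidate σ r t (r t) := ⟨r, hr, rfl, rfl⟩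
  exact hfg _ _ ((hx _ hcand').trans (hx _ hcand).symm)

/-- A digraph of diameter at most two with large out-degrees needs many cops. -/
lemma not_copsWin_of_outdegree [Fintype V] [Nonempty V] {k : ℕ}
    (hpath : ∀ u v, u ≠ v → ∃ w, G.Adj u w ∧ G.Adj w v)
    (hdeg : ∀ x, ∃ s : Finset V, (∀ y ∈ s, G.Adj x y) ∧ 2 ^ k + k < s.card) :
    ¬ G.CopsWin k := by
  classical
  refine not_copsWin_of_exists_pair fun u x => ?_
  obtain ⟨s, hs, hc⟩ := hdeg x
  have h1 : (Finset.univ.image u).card ≤ k := by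
    simpa using Finset.card_image_le (s := (Finset.univ : Finset (Fin k))) (f := u)
  have h2 := Finset.le_card_sdiff (Finset.univ.image u) s
  -- Off the probed vertices each distance is 1 or 2, so the adjacency pattern determines the whole
  -- vector. Discarding at most `k` probed vertices leaves more than `2 ^ k`.
  obtain ⟨y, hy, z, hz, hyz, he⟩ := Finset.exists_ne_map_eq_of_card_lt_of_maps_to
    (s := s \ Finset.univ.image u) (t := (Finset.univ : Finset (Fin k → Bool)))
    (f := fun y i => decide (G.Adj (u i) y)) (by simp; omega) (fun _ _ => by simp)
  simp only [Finset.mem_sdiff, Finset.mem_image, Finset.mem_univ, true_and, not_exists] at hy hz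
  refine ⟨y, z, hyz, hs y hy.1, hs z hz.1, funext fun i => ?_⟩
  have hi : G.Adj (u i) y ↔ G.Adj (u i) z := by simpa using congrFun he i
  obtain ⟨w, hw, hw'⟩ := hpath _ _ (hy.2 i)
  obtain ⟨w₂, hw₂, hw₂'⟩ := hpath _ _ (hz.2 i)
  by_cases ha : G.Adj (u i) y
  · simp only [distVector, dirDist_eq_one (hy.2 i) ha, dirDist_eq_one (hz.2 i) (hi.1 ha)]
  · simp only [distVector, dirDist_eq_two (hy.2 i) ha hw hw',
      dirDist_eq_two (hz.2 i) (fun h => ha (hi.2 h)) hw₂ hw₂']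

end Digraph

/-! ### Independent bits -/

section Bits

variable {E ι : Type*} [Fintype E] [Fintype ι]

lemma pi_bernoulli_real_box (p : unitInterval) (e : ι → E) (he : e.Injective) (s : ι → Bool) :
    (Measure.pi fun _ : E => bernoulliMeasure true false p).real {b | ∀ i, b (e i) = s i} =
      ∏ i, (bernoulliMeasure true false p).real {s i} := by
  have h := (iIndepFun_pi (μ := fun _ : E => bernoulliMeasure true false p)
    (X := fun _ b => b) fun _ => aemeasurable_id).precomp he
  have h2 := h.measure_inter_preimage_eq_mul Finset.univ (sets := fun i => {s i})
    (fun i _ => .of_discrete)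
  have h3 : {b : E → Bool | ∀ i, b (e i) = s i} =
      ⋂ i ∈ (Finset.univ : Finset ι), (fun b : E → Bool => b (e i)) ⁻¹' {s i} := by
    ext b; simp
  rw [h3, measureReal_def, h2, ENNReal.toReal_prod]
  refine Finset.prod_congr rfl fun i _ => ?_
  have := (measurePreserving_eval (fun _ : E => bernoulliMeasure true false p)
    (e i)).measure_preimage (s := {s i}) (MeasurableSet.singleton _).nullMeasurableSet
  rw [measureReal_def, ← this]

/-- Constraints on pairwise disjoint pairs of bits: the probability that all hold is at most the
product of the individual probabilities. -/
lemma pi_bernoulli_real_pairs_le (p : unitInterval) (e : ι ⊕ ι → E) (he : e.Injective)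
    (T : ι → Finset (Bool × Bool)) :
    (Measure.pi fun _ : E => bernoulliMeasure true false p).real
        {b | ∀ i, (b (e (.inl i)), b (e (.inr i))) ∈ T i} ≤
      ∏ i, ∑ t ∈ T i, (bernoulliMeasure true false p).real {t.1} *
        (bernoulliMeasure true false p).real {t.2} := by
  classical
  rw [Finset.prod_univ_sum]
  -- The product of sums is expanded over choice functions `s`, each prescribing all the bits
  -- involved.
  calc _ ≤ (Measure.pi fun _ : E => bernoulliMeasure true false p).real
        (⋃ s ∈ Fintype.piFinset T, {b | ∀ j, b (e j) =
          Sum.elim (fun i => (s i).1) (fun i => (s i).2) j}) := by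
        refine measureReal_mono (fun b hb => ?_) (measure_ne_top _ _)
        simp only [Set.mem_iUnion]
        refine ⟨fun i => (b (e (.inl i)), b (e (.inr i))), Fintype.mem_piFinset.2 hb, ?_⟩
        rintro (j | j) <;> rfl
    _ ≤ _ := measureReal_biUnion_finset_le _ _
    _ = _ := by
        refine Finset.sum_congr rfl fun s _ => ?_
        rw [pi_bernoulli_real_box p e he, Fintype.prod_sum_type, ← Finset.prod_mul_distrib]
        rfl

end Bits

/-! ### Encoding tournaments by bits -/

section ArcIndex

variable {n : ℕ}

/-- The position of the bit that decides the arc between `u` and `v`. -/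
def arcIndex (u v : Fin n) (h : u ≠ v) : {e : Fin n × Fin n // e.1 < e.2} :=
  if huv : u < v then ⟨(u, v), huv⟩ else ⟨(v, u), lt_of_le_of_ne (not_lt.1 huv) h.symm⟩

lemma arcIndex_eq_iff {u v x y : Fin n} (h : u ≠ v) (h' : x ≠ y) :
    arcIndex u v h = arcIndex x y h' ↔ (u = x ∧ v = y) ∨ (u = y ∧ v = x) := by
  unfold arcIndex
  split_ifs <;> simp only [Subtype.mk.injEq, Prod.mk.injEq] <;> grind

lemma adj_tournamentOfBits {u v : Fin n} (h : u ≠ v)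
    (b : {e : Fin n × Fin n // e.1 < e.2} → Bool) :
    (tournamentOfBits b).Adj u v ↔ b (arcIndex u v h) = decide (u < v) := by
  unfold arcIndex
  simp only [tournamentOfBits]
  by_cases huv : u < v
  · simp [huv, huv.not_gt]
  · have hvu : v < u := lt_of_le_of_ne (not_lt.1 huv) h.symm
    simp [huv, hvu]

lemma isTournament_tournamentOfBits (b : {e : Fin n × Fin n // e.1 < e.2} → Bool) :
    (tournamentOfBits b).IsTournament := by
  refine ⟨fun v => by simp [tournamentOfBits], fun u v h => ?_⟩
  rw [adj_tournamentOfBits h, adj_tournamentOfBits h.symm,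
    show arcIndex v u h.symm = arcIndex u v h from (arcIndex_eq_iff _ _).2 (.inr ⟨rfl, rfl⟩)]
  rcases lt_or_gt_of_ne h with h' | h' <;> cases b (arcIndex u v h) <;>
    simp [h', h'.not_gt, Xor]

lemma tournamentOfBits_injective : Function.Injective (tournamentOfBits (n := n)) := by
  intro b b' h
  funext ⟨⟨u, v⟩, huv⟩
  have huv' : u < v := huv
  have := congrFun (congrFun (congrArg Digraph.Adj h) u) v
  simpa [tournamentOfBits, huv', huv'.not_gt] using this

lemma range_tournamentOfBits :
    Set.range (tournamentOfBits (n := n)) = {G : Digraph (Fin n) | G.IsTournament} := by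
  classical
  refine Set.Subset.antisymm (by rintro _ ⟨b, rfl⟩; exact isTournament_tournamentOfBits b) ?_
  intro G hG
  refine ⟨fun e => decide (G.Adj e.1.1 e.1.2), ?_⟩
  ext u v
  by_cases h : u = v
  · subst h
    simp [tournamentOfBits, hG.1 u]
  · have := hG.2 u v h
    rcases lt_or_gt_of_ne h with h' | h' <;> simp [tournamentOfBits, h', h'.not_gt]
    rw [Xor] at this
    tauto

end ArcIndex

/-! ### The law of the random tournament -/

lemma randomTournament_real (n : ℕ) (p : unitInterval) (A : Set (Digraph (Fin n))) :
    (randomTournament n p).real A =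
      (Measure.pi fun _ : {e : Fin n × Fin n // e.1 < e.2} =>
        bernoulliMeasure true false p).real (tournamentOfBits ⁻¹' A) := by
  rw [randomTournament, map_measureReal_apply .of_discrete .of_discrete]

instance (n : ℕ) (p : unitInterval) : IsProbabilityMeasure (randomTournament n p) :=
  Measure.isProbabilityMeasure_map Measurable.of_discrete.aemeasurable

/-- For `p = 1 / 2` the random tournament is uniformly distributed over all tournaments. -/
lemma randomTournament_half_real (n : ℕ) (p : unitInterval) (hp : (p : ℝ) = 1 / 2)
    (A : Set (Digraph (Fin n))) :
    (randomTournament n p).real A =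
      (Set.ncard {G : Digraph (Fin n) | G.IsTournament ∧ G ∈ A} : ℝ) /
        (Set.ncard {G : Digraph (Fin n) | G.IsTournament} : ℝ) := by
  classical
  set E := {e : Fin n × Fin n // e.1 < e.2}
  have hsingle : ∀ b : E → Bool,
      (Measure.pi fun _ : E => bernoulliMeasure true false p).real {b} =
        1 / 2 ^ Fintype.card E := by
    intro b
    have := pi_bernoulli_real_box p (id : E → E) Function.injective_id b
    rw [show ({b} : Set (E → Bool)) = {b' | ∀ i, b' (id i) = b i} by ext; simp [funext_iff], this]
    have hs : ∀ c : Bool, (bernoulliMeasure true false p).real {c} = 1 / 2 := by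
      intro c
      rw [bernoulliMeasure_real_apply p .of_discrete]
      cases c <;> simp [hp]
      norm_num
    simp [hs]
  have h1 : {G : Digraph (Fin n) | G.IsTournament ∧ G ∈ A} =
      tournamentOfBits '' (tournamentOfBits ⁻¹' A) := by
    rw [Set.image_preimage_eq_inter_range, range_tournamentOfBits, Set.inter_comm]
    rfl
  rw [h1, ← range_tournamentOfBits, Set.ncard_image_of_injective _ tournamentOfBits_injective,
    ← Set.image_univ, Set.ncard_image_of_injective _ tournamentOfBits_injective,
    randomTournament_real, Set.ncard_eq_toFinset_card', Set.ncard_univ, Nat.card_eq_fintype_card,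
    Fintype.card_fun, Fintype.card_bool]
  conv_lhs => rw [← Set.coe_toFinset (tournamentOfBits ⁻¹' A)]
  rw [← sum_measureReal_singleton]
  simp [hsingle, div_eq_mul_inv, E]

/-! ### Probabilities for a fixed pair of vertices -/

section Events

variable {n : ℕ} (p : unitInterval)

lemma randomTournament_real_indistinguishable_le (s : Finset (Fin n)) {x y : Fin n}
    (hxy : x ≠ y) (hx : x ∉ s) (hy : y ∉ s) :
    (randomTournament n p).real {G | ∀ u ∈ s, G.Adj u x ↔ G.Adj u y} ≤
      ((p : ℝ) ^ 2 + (1 - p) ^ 2) ^ s.card := by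
  have hux : ∀ u : s, (u : Fin n) ≠ x := fun u h => hx (h ▸ u.2)
  have huy : ∀ u : s, (u : Fin n) ≠ y := fun u h => hy (h ▸ u.2)
  rw [randomTournament_real]
  let e : s ⊕ s → {e : Fin n × Fin n // e.1 < e.2} :=
    Sum.elim (fun u => arcIndex u x (hux u)) (fun u => arcIndex u y (huy u))
  have he : e.Injective := by
    rintro (⟨a, ha⟩ | ⟨a, ha⟩) (⟨c, hc⟩ | ⟨c, hc⟩) h <;>
      simp only [e, Sum.elim_inl, Sum.elim_inr, arcIndex_eq_iff] at h <;> grind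
  let T : s → Finset (Bool × Bool) := fun u =>
    Finset.univ.filter fun t => (t.1 = decide (u.1 < x)) ↔ (t.2 = decide (u.1 < y))
  have key := pi_bernoulli_real_pairs_le p e he T
  have hset : tournamentOfBits ⁻¹' {G : Digraph (Fin n) | ∀ u ∈ s, G.Adj u x ↔ G.Adj u y} =
      {b | ∀ i : s, (b (e (.inl i)), b (e (.inr i))) ∈ T i} := by
    ext b
    simp only [Set.mem_preimage, Set.mem_ofPred_eq, T, Finset.mem_filter, Finset.mem_univ,
      true_and, e, Sum.elim_inl, Sum.elim_inr, Subtype.forall]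
    refine forall₂_congr fun u hu => ?_
    rw [adj_tournamentOfBits (hux ⟨u, hu⟩), adj_tournamentOfBits (huy ⟨u, hu⟩)]
  rw [hset]
  refine key.trans ?_
  rw [← Fintype.card_coe s, ← Finset.card_univ, ← Finset.prod_const]
  refine Finset.prod_le_prod (fun _ _ => Finset.sum_nonneg fun _ _ => by positivity) fun u _ => ?_
  -- Bits record arcs relative to the order, so if `u` lies between `x` and `y`, equal adjacency
  -- means opposite bits.
  have hT : T u = if u.1 < x ↔ u.1 < y then {(true, true), (false, false)}
      else {(true, false), (false, true)} := by
    ext ⟨t, t'⟩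
    by_cases h1 : u.1 < x <;> by_cases h2 : u.1 < y <;> cases t <;> cases t' <;> simp [T, h1, h2]
  rw [hT]
  split_ifs
  · simp [bernoulliMeasure_real_apply p .of_discrete]
    exact le_of_eq (by ring)
  · simp [bernoulliMeasure_real_apply p .of_discrete]
    -- Opposite bits have probability `2p(1 - p)`, which is `ρ - (2p - 1)²`.
    nlinarith [sq_nonneg (2 * (p : ℝ) - 1)]

/-- Each midpoint works for exactly one of its four bit patterns, of probability at least `min p (1
- p) ^ 2`; distinct midpoints use disjoint pairs of bits. -/
lemma randomTournament_real_no_path_le (s : Finset (Fin n)) {u v : Fin n} (huv : u ≠ v)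
    (hu : u ∉ s) (hv : v ∉ s) :
    (randomTournament n p).real {G | ∀ w ∈ s, ¬ (G.Adj u w ∧ G.Adj w v)} ≤
      (1 - min (p : ℝ) (1 - p) ^ 2) ^ s.card := by
  have huw : ∀ w : s, u ≠ w := fun w h => hu (h ▸ w.2)
  have hwv : ∀ w : s, (w : Fin n) ≠ v := fun w h => hv (h ▸ w.2)
  rw [randomTournament_real]
  let e : s ⊕ s → {e : Fin n × Fin n // e.1 < e.2} :=
    Sum.elim (fun w => arcIndex u w (huw w)) (fun w => arcIndex w v (hwv w))
  have he : e.Injective := by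
    rintro (⟨a, ha⟩ | ⟨a, ha⟩) (⟨c, hc⟩ | ⟨c, hc⟩) h <;>
      simp only [e, Sum.elim_inl, Sum.elim_inr, arcIndex_eq_iff] at h <;> grind
  let T : s → Finset (Bool × Bool) := fun w =>
    Finset.univ.erase (decide (u < w.1), decide (w.1 < v))
  have key := pi_bernoulli_real_pairs_le p e he T
  have hset : tournamentOfBits ⁻¹' {G : Digraph (Fin n) | ∀ w ∈ s, ¬ (G.Adj u w ∧ G.Adj w v)} =
      {b | ∀ i : s, (b (e (.inl i)), b (e (.inr i))) ∈ T i} := by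
    ext b
    simp only [Set.mem_preimage, Set.mem_ofPred_eq, T, Finset.mem_erase, Finset.mem_univ,
      and_true, e, Sum.elim_inl, Sum.elim_inr, Subtype.forall, ne_eq, Prod.mk.injEq]
    refine forall₂_congr fun w hw => ?_
    rw [adj_tournamentOfBits (huw ⟨w, hw⟩), adj_tournamentOfBits (hwv ⟨w, hw⟩)]
  rw [hset]
  refine key.trans ?_
  rw [← Fintype.card_coe s, ← Finset.card_univ, ← Finset.prod_const]
  refine Finset.prod_le_prod (fun _ _ => Finset.sum_nonneg fun _ _ => by positivity) fun w _ => ?_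
  have hone : ∑ t : Bool × Bool, (bernoulliMeasure true false p).real {t.1} *
      (bernoulliMeasure true false p).real {t.2} = 1 := by
    rw [Fintype.sum_prod_type]
    simp [bernoulliMeasure_real_apply p .of_discrete]
    ring
  have hmin : ∀ c : Bool, min (p : ℝ) (1 - p) ≤ (bernoulliMeasure true false p).real {c} := by
    intro c
    rw [bernoulliMeasure_real_apply p .of_discrete]
    cases c <;> simp
  have h0 : 0 ≤ min (p : ℝ) (1 - p) := le_min p.2.1 (by linarith [p.2.2])
  rw [Finset.sum_erase_eq_sub (Finset.mem_univ _), hone, sq]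
  have := mul_le_mul (hmin (decide (u < w.1))) (hmin (decide (w.1 < v))) h0
    measureReal_nonneg
  linarith

end Events

/-! ### Union bounds for fixed `n` -/

section FiniteBounds

variable {n : ℕ} (p : unitInterval)

lemma randomTournament_real_not_copsWin_le {k : ℕ} (hk : k ≤ n) :
    (randomTournament n p).real {G | ¬ G.CopsWin k} ≤
      (n : ℝ) ^ 2 * ((p : ℝ) ^ 2 + (1 - p) ^ 2) ^ k := by
  classical
  let s : Finset (Fin n) := Finset.univ.map (Fin.castLEEmb hk)
  have hs : s.card = k := by simp [s]
  have hsub : {G : Digraph (Fin n) | ¬ G.CopsWin k} ⊆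
      ⋃ q ∈ (sᶜ).offDiag, {G | ∀ u ∈ s, G.Adj u q.1 ↔ G.Adj u q.2} := by
    intro G hG
    by_contra hcon
    simp only [Set.mem_iUnion, not_exists, Finset.mem_offDiag, Finset.mem_compl] at hcon
    refine hG (Digraph.copsWin_of_resolving (Fin.castLE hk) fun x y hxy => ?_)
    have hmem : ∀ z ∈ s, ∃ i, Fin.castLE hk i = z := by simp [s]
    by_cases hx : x ∈ s
    · obtain ⟨i, hi⟩ := hmem x hx
      exact ⟨i, Digraph.dirDist_ne_of_adj_ne (.inl hi) hxy⟩
    by_cases hy : y ∈ s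
    · obtain ⟨i, hi⟩ := hmem y hy
      exact ⟨i, Digraph.dirDist_ne_of_adj_ne (.inr (.inl hi)) hxy⟩
    have := hcon (x, y) ⟨hx, hy, hxy⟩
    simp only [Set.mem_ofPred_eq, not_forall] at this
    obtain ⟨u, hu, h⟩ := this
    obtain ⟨i, rfl⟩ := hmem u hu
    exact ⟨i, Digraph.dirDist_ne_of_adj_ne (.inr (.inr h)) hxy⟩
  have hnn : 0 ≤ ((p : ℝ) ^ 2 + (1 - p) ^ 2) ^ k := by positivity
  calc _ ≤ _ := measureReal_mono hsub (measure_ne_top _ _)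
    _ ≤ _ := measureReal_biUnion_finset_le _ _
    _ ≤ ∑ q ∈ (sᶜ).offDiag, ((p : ℝ) ^ 2 + (1 - p) ^ 2) ^ k := by
        refine Finset.sum_le_sum fun q hq => ?_
        simp only [Finset.mem_offDiag, Finset.mem_compl] at hq
        exact hs ▸ randomTournament_real_indistinguishable_le p s hq.2.2 hq.1 hq.2.1
    _ ≤ _ := by
        rw [Finset.sum_const, nsmul_eq_mul]
        refine mul_le_mul_of_nonneg_right ?_ hnn
        have h1 : (sᶜ).offDiag.card ≤ n ^ 2 := by
          refine (Finset.card_le_univ _).trans ?_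
          simp [sq]
        exact_mod_cast h1

/-- Between any two vertices there is a path of length two through each of the `n / L` blocks of
`L` consecutive vertices. -/
def HasBlockPaths (L : ℕ) (G : Digraph (Fin n)) : Prop :=
  ∀ u v : Fin n, u ≠ v → ∀ i : Fin (n / L), ∃ w : Fin n, w.1 / L = i ∧ G.Adj u w ∧ G.Adj w v

/-- Blocks are disjoint, so the midpoints of the paths from `x` to any other vertex are distinct
out-neighbours of `x`, one per block. -/
lemma HasBlockPaths.not_copsWin {L k : ℕ} {G : Digraph (Fin n)} (hG : HasBlockPaths L G)
    (hn : 2 ≤ n) (hk : 2 ^ k + k < n / L) : ¬ G.CopsWin k := by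
  classical
  have : Nontrivial (Fin n) := Fin.nontrivial_iff_two_le.2 hn
  refine Digraph.not_copsWin_of_outdegree (fun u v huv => ?_) fun x => ?_
  · obtain ⟨w, -, hw⟩ := hG u v huv ⟨0, (Nat.zero_le _).trans_lt hk⟩
    exact ⟨w, hw⟩
  · obtain ⟨v, hv⟩ := exists_ne x
    choose f hf hxf _ using hG x v hv.symm
    have hinj : f.Injective := fun i j hij => Fin.ext (by rw [← hf, ← hf, hij])
    refine ⟨Finset.univ.image f, by simpa using hxf, ?_⟩
    rwa [Finset.card_image_of_injective _ hinj, Finset.card_univ, Fintype.card_fin]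

lemma randomTournament_real_not_hasBlockPaths_le {L : ℕ} :
    (randomTournament n p).real {G | ¬ HasBlockPaths L G} ≤
      (n : ℝ) ^ 3 * (1 - min (p : ℝ) (1 - p) ^ 2) ^ (L - 2) := by
  classical
  -- Since `n / 0 = 0`, there are no blocks when `L = 0`.
  rcases Nat.eq_zero_or_pos L with rfl | hL
  · have : {G : Digraph (Fin n) | ¬ HasBlockPaths 0 G} = ∅ := by
      ext G
      simp only [Set.mem_ofPred_eq, Set.mem_empty_iff_false, iff_false, not_not]
      intro u v _ i
      exact absurd i.2 (by simp)
    simp [this]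
  let B : Fin (n / L) → Fin n → Fin n → Finset (Fin n) := fun i u v =>
    ((Finset.univ.filter fun w : Fin n => w.1 / L = i).erase u).erase v
  have hB : ∀ i u v, L - 2 ≤ (B i u v).card := by
    intro i u v
    have hi : (i.1 + 1) * L ≤ n := by
      calc _ ≤ n / L * L := Nat.mul_le_mul_right _ i.2
        _ ≤ n := Nat.div_mul_le_self n L
    have h1 : L ≤ (Finset.univ.filter fun w : Fin n => w.1 / L = i).card := by
      have := Finset.card_le_card_of_injOn (s := (Finset.univ : Finset (Fin L)))
        (t := Finset.univ.filter fun w : Fin n => w.1 / L = i)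
        (fun j => ⟨i.1 * L + j.1, by have := j.2; rw [add_mul, one_mul] at hi; omega⟩)
        (fun j _ => by
          simp only [Finset.coe_filter, Finset.mem_univ, true_and, Set.mem_ofPred_eq]
          rw [Nat.div_eq_iff hL]
          have := j.2
          constructor <;> omega)
        (fun j _ j' _ h => by simpa [Fin.ext_iff] using h)
      simpa using this
    have h2 := Finset.pred_card_le_card_erase
      (s := Finset.univ.filter fun w : Fin n => w.1 / L = i) (a := u)
    have h3 := Finset.pred_card_le_card_erase
      (s := (Finset.univ.filter fun w : Fin n => w.1 / L = i).erase u) (a := v)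
    simp only [B]
    omega
  have hsub : {G : Digraph (Fin n) | ¬ HasBlockPaths L G} ⊆
      ⋃ q ∈ (Finset.univ : Finset (Fin n)).offDiag ×ˢ (Finset.univ : Finset (Fin (n / L))),
        {G | ∀ w ∈ B q.2 q.1.1 q.1.2, ¬ (G.Adj q.1.1 w ∧ G.Adj w q.1.2)} := by
    intro G hG
    simp only [HasBlockPaths, Set.mem_ofPred_eq, not_forall] at hG
    obtain ⟨u, v, huv, i, h⟩ := hG
    refine Set.mem_biUnion (x := ((u, v), i)) (by simp [huv]) fun w hw hadj => h ⟨w, ?_, hadj⟩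
    simp only [B, Finset.mem_erase, Finset.mem_filter] at hw
    exact hw.2.2.2
  have h0 : 0 ≤ min (p : ℝ) (1 - p) := le_min p.2.1 (by linarith [p.2.2])
  have hle : min (p : ℝ) (1 - p) ≤ 1 := (min_le_left _ _).trans p.2.2
  have hq0 : 0 ≤ 1 - min (p : ℝ) (1 - p) ^ 2 := by nlinarith
  have hq1 : 1 - min (p : ℝ) (1 - p) ^ 2 ≤ 1 := by nlinarith
  calc _ ≤ _ := measureReal_mono hsub (measure_ne_top _ _)
    _ ≤ _ := measureReal_biUnion_finset_le _ _
    _ ≤ ∑ q ∈ (Finset.univ : Finset (Fin n)).offDiag ×ˢ (Finset.univ : Finset (Fin (n / L))),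
        (1 - min (p : ℝ) (1 - p) ^ 2) ^ (L - 2) := by
        refine Finset.sum_le_sum fun q hq => ?_
        simp only [Finset.mem_product, Finset.mem_offDiag, Finset.mem_univ, true_and,
          and_true] at hq
        exact (randomTournament_real_no_path_le p _ hq (by simp [B]) (by simp [B])).trans
          (pow_le_pow_of_le_one hq0 hq1 (hB _ _ _))
    _ ≤ _ := by
        rw [Finset.sum_const, nsmul_eq_mul]
        refine mul_le_mul_of_nonneg_right ?_ (by positivity)
        have h1 : ((Finset.univ : Finset (Fin n)).offDiag ×ˢ
            (Finset.univ : Finset (Fin (n / L)))).card ≤ n ^ 3 := by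
          refine (Finset.card_le_univ _).trans ?_
          simp only [Fintype.card_prod, Fintype.card_fin]
          calc n * n * (n / L) ≤ n * n * n := Nat.mul_le_mul_left _ (Nat.div_le_self _ _)
            _ = n ^ 3 := by ring
        exact_mod_cast h1

lemma le_randomTournament_real_localizationNumber {k L : ℕ} (hn : 2 ≤ n) (hk0 : 0 < k)
    (hk : k ≤ n) :
    1 - (n : ℝ) ^ 2 * ((p : ℝ) ^ 2 + (1 - p) ^ 2) ^ k -
        (n : ℝ) ^ 3 * (1 - min (p : ℝ) (1 - p) ^ 2) ^ (L - 2) ≤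
      (randomTournament n p).real {G | n / L ≤ 2 ^ (G.localizationNumber + 1) ∧
        G.localizationNumber ≤ k} := by
  have hsub : {G : Digraph (Fin n) | n / L ≤ 2 ^ (G.localizationNumber + 1) ∧
      G.localizationNumber ≤ k}ᶜ ⊆ {G | ¬ G.CopsWin k} ∪ {G | ¬ HasBlockPaths L G} := by
    intro G hG
    by_contra hcon
    simp only [Set.mem_union, Set.mem_ofPred_eq, not_or, not_not] at hcon
    have hmem : k ∈ {k : ℕ | 0 < k ∧ G.CopsWin k} := ⟨hk0, hcon.1⟩
    -- A winning `k` makes the set nonempty, so the infimum is attained and is not the default 0.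
    have hz : 0 < G.localizationNumber ∧ G.CopsWin G.localizationNumber := Nat.sInf_mem ⟨k, hmem⟩
    refine hG ⟨?_, Nat.sInf_le hmem⟩
    by_contra hlt
    refine hcon.2.not_copsWin hn ?_ hz.2
    -- `k < 2 ^ k` absorbs the `k` in `2 ^ k + k`; this is the source of the exponent `ζ + 1`.
    have := Nat.lt_two_pow_self (n := G.localizationNumber)
    rw [pow_succ] at hlt
    omega
  have h1 := measureReal_mono (μ := randomTournament n p) hsub (measure_ne_top _ _)
  have h2 := measureReal_union_le (μ := randomTournament n p)
    {G : Digraph (Fin n) | ¬ G.CopsWin k} {G | ¬ HasBlockPaths L G}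
  have h3 := randomTournament_real_not_copsWin_le p hk
  have h4 := randomTournament_real_not_hasBlockPaths_le (n := n) p (L := L)
  rw [probReal_compl_eq_one_sub .of_discrete] at h1
  linarith

end FiniteBounds

/-! ### Asymptotics of the parameters -/

section Asymptotics

lemma tendsto_log_natCast : Tendsto (fun n : ℕ => Real.log n) atTop atTop :=
  Real.tendsto_log_atTop.comp tendsto_natCast_atTop_atTop

/-- The number of cops that almost surely resolve the random tournament. -/
noncomputable def copCount (l : ℝ) (n : ℕ) : ℕ := ⌈2 * Real.log n / l + √(Real.log n)⌉₊

/-- The block length for the lower bound. -/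
noncomputable def blockLength (n : ℕ) : ℕ := ⌈Real.log n ^ 2⌉₊

lemma copCount_pos {l : ℝ} (hl : 0 < l) {n : ℕ} (hn : 2 ≤ n) : 0 < copCount l n := by
  have : 0 < Real.log n := Real.log_pos (by exact_mod_cast hn)
  exact Nat.ceil_pos.2 (by positivity)

lemma tendsto_copCount_div {l : ℝ} (hl : 0 < l) :
    Tendsto (fun n : ℕ => (copCount l n : ℝ) / Real.log n) atTop (𝓝 (2 / l)) := by
  have hs : Tendsto (fun n : ℕ => (√(Real.log n))⁻¹) atTop (𝓝 0) :=
    (Real.tendsto_sqrt_atTop.comp tendsto_log_natCast).inv_tendsto_atTop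
  have hi : Tendsto (fun n : ℕ => (Real.log n)⁻¹) atTop (𝓝 0) :=
    tendsto_log_natCast.inv_tendsto_atTop
  have hlow : Tendsto (fun n : ℕ => 2 / l + (√(Real.log n))⁻¹) atTop (𝓝 (2 / l)) := by
    simpa using hs.const_add (2 / l)
  have hup : Tendsto (fun n : ℕ => 2 / l + (√(Real.log n))⁻¹ + (Real.log n)⁻¹) atTop
      (𝓝 (2 / l)) := by
    simpa using hlow.add hi
  have hdiv : ∀ x : ℝ, 0 < x → (2 * x / l + √x) / x = 2 / l + (√x)⁻¹ := by
    intro x hx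
    have h1 : √x ≠ 0 := (Real.sqrt_pos.2 hx).ne'
    nth_rw 3 [← Real.mul_self_sqrt hx.le]
    nth_rw 1 [← Real.mul_self_sqrt hx.le]
    field_simp
  refine tendsto_of_tendsto_of_tendsto_of_le_of_le' hlow hup ?_ ?_
  · filter_upwards [tendsto_log_natCast.eventually_gt_atTop 0] with n hn
    rw [← hdiv _ hn]
    gcongr
    exact Nat.le_ceil _
  · filter_upwards [tendsto_log_natCast.eventually_gt_atTop 0] with n hn
    rw [← hdiv _ hn, ← one_div, ← add_div]
    gcongr
    exact (Nat.ceil_lt_add_one (by positivity)).le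

lemma eventually_copCount_le {l : ℝ} (hl : 0 < l) : ∀ᶠ n : ℕ in atTop, copCount l n ≤ n := by
  have h1 : Tendsto (fun n : ℕ => Real.log n / n) atTop (𝓝 0) :=
    (Real.isLittleO_log_id_atTop.tendsto_div_nhds_zero).comp tendsto_natCast_atTop_atTop
  have h2 := (tendsto_copCount_div hl).mul h1
  rw [mul_zero] at h2
  filter_upwards [h2.eventually_lt_const one_pos, tendsto_log_natCast.eventually_gt_atTop 0,
    eventually_gt_atTop 0] with n hn hlog hn0
  have hn0' : (0 : ℝ) < n := by exact_mod_cast hn0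
  rw [div_mul_div_cancel₀ hlog.ne', div_lt_one hn0'] at hn
  exact_mod_cast hn.le

/-- The summand `√(log n)` in `copCount`, negligible against `log n`, leaves the factor `exp (-l
√(log n))` here. -/
lemma tendsto_sq_mul_pow_copCount {ρ : ℝ} (h0 : 0 < ρ) (h1 : ρ < 1) :
    Tendsto (fun n : ℕ => (n : ℝ) ^ 2 * ρ ^ copCount (Real.log (1 / ρ)) n) atTop (𝓝 0) := by
  set l := Real.log (1 / ρ) with hl
  have hl0 : 0 < l := Real.log_pos ((one_lt_div h0).2 h1)
  have hlim : Tendsto (fun n : ℕ => Real.exp (-(l * √(Real.log n)))) atTop (𝓝 0) :=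
    Real.tendsto_exp_neg_atTop_nhds_zero.comp
      ((Real.tendsto_sqrt_atTop.comp tendsto_log_natCast).const_mul_atTop hl0)
  refine squeeze_zero' (.of_forall fun n => by positivity) ?_ hlim
  filter_upwards [eventually_gt_atTop 0] with n hn
  have hn' : (0 : ℝ) < n := by exact_mod_cast hn
  have hρ : ρ = Real.exp (-l) := by
    rw [hl, one_div, Real.log_inv, neg_neg, Real.exp_log h0]
  have hk : 2 * Real.log n / l + √(Real.log n) ≤ copCount l n := Nat.le_ceil _
  have hk' : 2 * Real.log n + l * √(Real.log n) ≤ l * copCount l n := by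
    calc _ = l * (2 * Real.log n / l + √(Real.log n)) := by field_simp
      _ ≤ _ := by gcongr
  calc _ = Real.exp (2 * Real.log n - l * copCount l n) := by
        nth_rw 1 [hρ, ← Real.exp_log hn']
        rw [← Real.exp_nat_mul, ← Real.exp_nat_mul, ← Real.exp_add]
        congr 1
        push_cast
        ring
    _ ≤ _ := Real.exp_le_exp.2 (by linarith)

/-- With `q = exp (-d)`, the exponent is at most `3 log n - d log² n + 2d`, hence at most `-log n +
2d` once `d log n ≥ 4`. -/
lemma tendsto_cube_mul_pow_blockLength {q : ℝ} (h0 : 0 < q) (h1 : q < 1) :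
    Tendsto (fun n : ℕ => (n : ℝ) ^ 3 * q ^ (blockLength n - 2)) atTop (𝓝 0) := by
  obtain ⟨d, hd0, hd⟩ : ∃ d, 0 < d ∧ q = Real.exp (-d) :=
    ⟨-Real.log q, neg_pos.2 (Real.log_neg h0 h1), by rw [neg_neg, Real.exp_log h0]⟩
  have hlim : Tendsto (fun n : ℕ => Real.exp (-(Real.log n - 2 * d))) atTop (𝓝 0) :=
    Real.tendsto_exp_neg_atTop_nhds_zero.comp
      (tendsto_atTop_add_const_right _ _ tendsto_log_natCast)
  refine squeeze_zero' (.of_forall fun n => by positivity) ?_ hlim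
  filter_upwards [eventually_gt_atTop 0, tendsto_log_natCast.eventually_ge_atTop (4 / d),
    tendsto_log_natCast.eventually_ge_atTop 0] with n hn hlog hlog0
  have hn' : (0 : ℝ) < n := by exact_mod_cast hn
  have hL : Real.log n ^ 2 ≤ blockLength n := Nat.le_ceil _
  have hL2 : (blockLength n : ℝ) ≤ (blockLength n - 2 : ℕ) + 2 := by
    exact_mod_cast (by omega : blockLength n ≤ blockLength n - 2 + 2)
  have h4 : 4 ≤ d * Real.log n := by rwa [div_le_iff₀' hd0] at hlog
  calc _ = Real.exp (3 * Real.log n - d * (blockLength n - 2 : ℕ)) := by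
        nth_rw 1 [hd, ← Real.exp_log hn']
        rw [← Real.exp_nat_mul, ← Real.exp_nat_mul, ← Real.exp_add]
        congr 1
        push_cast
        ring
    _ ≤ _ := Real.exp_le_exp.2 (by nlinarith)

/-- Eventually `n / L ≥ n / (4 log² n)`, so the blocks cost only `2 log log n + O(1)` in the
logarithm. -/
lemma tendsto_logb_div_blockLength :
    Tendsto (fun n : ℕ => (Real.logb 2 (n / blockLength n : ℕ) - 1) / Real.logb 2 n) atTop
      (𝓝 1) := by
  have hi : Tendsto (fun n : ℕ => (Real.log n)⁻¹) atTop (𝓝 0) :=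
    tendsto_log_natCast.inv_tendsto_atTop
  have hll : Tendsto (fun n : ℕ => Real.log (Real.log n) / Real.log n) atTop (𝓝 0) :=
    (Real.isLittleO_log_id_atTop.tendsto_div_nhds_zero).comp tendsto_log_natCast
  have hlow : Tendsto (fun n : ℕ => 1 - 2 * (Real.log (Real.log n) / Real.log n) -
      (Real.log 4 + Real.log 2) * (Real.log n)⁻¹) atTop (𝓝 1) := by
    simpa using ((hll.const_mul 2).const_sub 1).sub (hi.const_mul (Real.log 4 + Real.log 2))
  have hlit : ∀ᶠ n : ℕ in atTop, 2 * Real.log n ^ 2 ≤ n := by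
    have := ((isLittleO_log_rpow_atTop (r := 1 / 2) (by norm_num)).bound
      (c := 1 / 2) (by norm_num))
    filter_upwards [tendsto_natCast_atTop_atTop.eventually this,
      tendsto_log_natCast.eventually_gt_atTop 0] with n hn hlog
    rw [← Real.sqrt_eq_rpow, Real.norm_of_nonneg hlog.le,
      Real.norm_of_nonneg (Real.sqrt_nonneg _)] at hn
    have := Real.sq_sqrt (Nat.cast_nonneg (α := ℝ) n)
    nlinarith [Real.sqrt_nonneg (n : ℝ)]
  have h2 : 0 < Real.log 2 := Real.log_pos one_lt_two
  have hrw : ∀ n : ℕ, (Real.logb 2 (n / blockLength n : ℕ) - 1) / Real.logb 2 n =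
      (Real.log (n / blockLength n : ℕ) - Real.log 2) / Real.log n := by
    intro n
    simp only [Real.logb]
    rw [div_sub_one h2.ne', div_div_div_cancel_right₀ h2.ne']
  simp only [hrw]
  refine tendsto_of_tendsto_of_tendsto_of_le_of_le' hlow tendsto_const_nhds ?_ ?_
  · filter_upwards [hlit, tendsto_log_natCast.eventually_ge_atTop 1, eventually_gt_atTop 0]
      with n hn hlog hn0
    have hn0' : (0 : ℝ) < n := by exact_mod_cast hn0
    have hLle : (blockLength n : ℝ) ≤ 2 * Real.log n ^ 2 := by
      have : (blockLength n : ℝ) < Real.log n ^ 2 + 1 := Nat.ceil_lt_add_one (by positivity)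
      nlinarith
    have hLn : blockLength n ≤ n := by exact_mod_cast hLle.trans hn
    have hLpos : 0 < blockLength n := Nat.ceil_pos.2 (by positivity)
    have hdiv : n ≤ 2 * blockLength n * (n / blockLength n) := by
      have h1 := Nat.div_add_mod n (blockLength n)
      have h2 := Nat.mod_lt n hLpos
      have h3 : blockLength n ≤ blockLength n * (n / blockLength n) :=
        Nat.le_mul_of_pos_right _ (Nat.div_pos hLn hLpos)
      nlinarith
    have hdiv' : (n : ℝ) ≤ 4 * Real.log n ^ 2 * (n / blockLength n : ℕ) := by
      calc (n : ℝ) ≤ 2 * blockLength n * (n / blockLength n : ℕ) := by exact_mod_cast hdiv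
        _ ≤ 2 * (2 * Real.log n ^ 2) * (n / blockLength n : ℕ) := by gcongr
        _ = _ := by ring
    have hm : (0 : ℝ) < (n / blockLength n : ℕ) := by exact_mod_cast Nat.div_pos hLn hLpos
    have hlogle := Real.log_le_log hn0' hdiv'
    rw [Real.log_mul (by positivity) hm.ne', Real.log_mul (by norm_num) (by positivity),
      Real.log_pow] at hlogle
    rw [le_div_iff₀ (by linarith)]
    push_cast at hlogle
    have hne : Real.log n ≠ 0 := by linarith
    field_simp
    linarith
  · filter_upwards [tendsto_log_natCast.eventually_gt_atTop 0] with n hn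
    rw [div_le_one hn]
    rcases Nat.eq_zero_or_pos (n / blockLength n) with h | h
    · simp only [h, Nat.cast_zero, Real.log_zero]
      linarith
    · have : Real.log (n / blockLength n : ℕ) ≤ Real.log n :=
        Real.log_le_log (by exact_mod_cast h) (by exact_mod_cast Nat.div_le_self _ _)
      linarith

end Asymptotics

/-! ### The main theorem -/

lemma exists_tendsto_randomTournament_localizationNumber (p : unitInterval) (hp0 : 0 < (p : ℝ))
    (hp1 : (p : ℝ) < 1) :
    ∃ ε₁ ε₂ : ℕ → ℝ, Tendsto ε₁ atTop (𝓝 0) ∧ Tendsto ε₂ atTop (𝓝 0) ∧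
      Tendsto (fun n : ℕ => (randomTournament n p).real
        {G : Digraph (Fin n) |
          (1 + ε₁ n) * Real.logb 2 n ≤ (G.localizationNumber : ℝ) ∧
          (G.localizationNumber : ℝ) ≤
            (2 + ε₂ n) * (Real.log n / Real.log (1 / ((p : ℝ) ^ 2 + (1 - p) ^ 2)))})
        atTop (𝓝 1) := by
  set ρ := (p : ℝ) ^ 2 + (1 - p) ^ 2
  have hρ0 : 0 < ρ := by positivity
  have hρ1 : ρ < 1 := by simp only [ρ]; nlinarith
  set l := Real.log (1 / ρ)
  have hl0 : 0 < l := Real.log_pos ((one_lt_div hρ0).2 hρ1)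
  have hc0 : 0 < min (p : ℝ) (1 - p) := lt_min hp0 (by linarith)
  have hc1 : min (p : ℝ) (1 - p) < 1 := (min_le_left _ _).trans_lt hp1
  -- The errors are chosen so that the two bounds become exactly `logb 2 (n / L) - 1` and `copCount
  -- l n`.
  refine ⟨fun n => (Real.logb 2 (n / blockLength n : ℕ) - 1) / Real.logb 2 n - 1,
    fun n => l * (copCount l n / Real.log n) - 2, ?_, ?_, ?_⟩
  · simpa using tendsto_logb_div_blockLength.sub_const 1
  · have := ((tendsto_copCount_div hl0).const_mul l).sub_const 2
    rwa [mul_div_cancel₀ _ hl0.ne', sub_self] at this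
  · have hlim := ((tendsto_sq_mul_pow_copCount hρ0 hρ1).const_sub 1).sub
      (tendsto_cube_mul_pow_blockLength (q := 1 - min (p : ℝ) (1 - p) ^ 2) (by nlinarith)
        (by nlinarith))
    rw [sub_zero, sub_zero] at hlim
    refine tendsto_of_tendsto_of_tendsto_of_le_of_le' hlim tendsto_const_nhds ?_
      (.of_forall fun n => measureReal_le_one)
    filter_upwards [eventually_ge_atTop 2, eventually_copCount_le hl0] with n hn hk
    refine (le_randomTournament_real_localizationNumber p hn (copCount_pos hl0 hn) hk).trans
      (measureReal_mono ?_ (measure_ne_top _ _))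
    rintro G ⟨hlow, hup⟩
    have hlog : 0 < Real.log n := Real.log_pos (by exact_mod_cast hn)
    have hlogb : 0 < Real.logb 2 n := Real.logb_pos one_lt_two (by exact_mod_cast hn)
    refine ⟨?_, ?_⟩
    · rw [add_sub_cancel, div_mul_cancel₀ _ hlogb.ne', sub_le_iff_le_add]
      -- If the quotient is 0, the convention `logb 2 0 = 0` makes the bound trivial.
      rcases Nat.eq_zero_or_pos (n / blockLength n) with h | h
      · simp only [h, Nat.cast_zero, Real.logb_zero]
        positivity
      · have h2 : ((n / blockLength n : ℕ) : ℝ) ≤ 2 ^ (G.localizationNumber + 1) := by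
          exact_mod_cast hlow
        have := Real.logb_le_logb_of_le one_lt_two (by exact_mod_cast h) h2
        rwa [Real.logb_pow, Real.logb_self_eq_one one_lt_two, mul_one, Nat.cast_add,
          Nat.cast_one] at this
    · have : (2 + (l * (copCount l n / Real.log n) - 2)) * (Real.log n / l) = copCount l n := by
        field_simp
        ring
      rw [this]
      exact_mod_cast hup

theorem mainTheorem9 :
    (∀ (p : ℝ) (hp0 : 0 < p) (hp1 : p < 1),
      ∃ ε₁ ε₂ : ℕ → ℝ, Tendsto ε₁ atTop (𝓝 0) ∧ Tendsto ε₂ atTop (𝓝 0) ∧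
        Tendsto (fun n : ℕ => (randomTournament n ⟨p, hp0.le, hp1.le⟩).real
          {G : Digraph (Fin n) |
            (1 + ε₁ n) * Real.logb 2 n ≤ (G.localizationNumber : ℝ) ∧
            (G.localizationNumber : ℝ) ≤
              (2 + ε₂ n) * (Real.log n / Real.log (1 / (p ^ 2 + (1 - p) ^ 2)))})
          atTop (𝓝 1)) ∧
    (∃ ε₁ ε₂ : ℕ → ℝ, Tendsto ε₁ atTop (𝓝 0) ∧ Tendsto ε₂ atTop (𝓝 0) ∧
      Tendsto (fun n : ℕ =>
        (Set.ncard {G : Digraph (Fin n) | G.IsTournament ∧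
            (1 + ε₁ n) * Real.logb 2 n ≤ (G.localizationNumber : ℝ) ∧
            (G.localizationNumber : ℝ) ≤ (2 + ε₂ n) * Real.logb 2 n} : ℝ) /
          (Set.ncard {G : Digraph (Fin n) | G.IsTournament} : ℝ))
        atTop (𝓝 1)) := by
  refine ⟨fun p hp0 hp1 =>
    exists_tendsto_randomTournament_localizationNumber ⟨p, hp0.le, hp1.le⟩ hp0 hp1, ?_⟩
  obtain ⟨ε₁, ε₂, h₁, h₂, h⟩ := exists_tendsto_randomTournament_localizationNumber
    ⟨1 / 2, by norm_num, by norm_num⟩ (by norm_num) (by norm_num)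
  refine ⟨ε₁, ε₂, h₁, h₂, h.congr fun n => ?_⟩
  rw [randomTournament_half_real n _ rfl]
  -- Here `ρ = 1 / 2`, so `log n / log (1 / ρ)` is `logb 2 n`.
  norm_num [Real.logb]
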